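/- Let $L$ be a finite non-empty list of $|L|$ items, let $g:L\to\{0,1\}$ be any Boolean function (an item $x$ is \emph{marked} if $g(x)=1$; the number of marked items is unknown), and let $\epsilon>0$. Let $O_g$ be the oracle $O_g|x\rangle|b\rangle=|x\rangle|b\oplus g(x)\rangle$, and let $c_q\in\mathbb{N}$ be the number of queries to $g$ needed to implement $O_g$ once. Put $$t_0=\left\lceil\frac{\ln\epsilon}{2\ln(3/4)}\right\rceil=\left\lceil\frac{\ln(1/\epsilon)}{2\ln(4/3)}\right\rceil ,$$ read as $t_0=0$ if $\epsilon\ge 1$. A \emph{Grover run with $j$ iterations} prepares the uniform superposition of all items, applies $j$ times the Grover iteration (a phase flip of the marked items, made with one use of $O_g$, followed by the reflection about the start state), and measures the item register. The outcome $x$ is then checked, i.e. $g(x)$ is read off, with one more use of $O_g$. An \emph{exact Grover run for $t$ marked items}, $t\ge 1$, does the same with $k_t=\lceil\frac{\pi}{4}\sqrt{|L|/t}-\frac12\rceil$ iterations, but starting from the uniform superposition together with a qubit in the state $\cos\varphi_t|0\rangle+\sin\varphi_t|1\rangle$, where $\sin\varphi_t=\sqrt{|L|/t}\,\sin\frac{\pi}{2(2k_t+1)}$;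 here the phase flip acts on the basis states in which the item is marked and the qubit is $|1\rangle$, again with one use of $O_g$ per iteration, and the reflection is about this start state. The algorithm $\mathrm{QSearch}_{\mathrm{Zalka}}(L,\epsilon)$ has two steps. 1. For $t=1,2,\dots,t_0$, perform an exact Grover run for $t$ marked items. As soon as a check finds a marked item, return it and stop. 2. Repeat $2t_0$ times: choose an integer $j$ uniformly at random from $\{0,1,\dots,\lceil\frac{\pi}{4}\sqrt{|L|/t_0}\rceil\}$ and perform a Grover run with $j$ iterations. As soon as a check finds a marked item, return it and stop. If no run finds one, report that there is no marked item. Then, for every $L$, $g$ and $\epsilon$ as above: (a) with probability at least $1-\epsilon$ the answer is correct, that is, a marked item of $L$ is returned if there is one, and otherwise it is reported that there is none; (b) in every possible execution, the number of queries to $g$, counted as $c_q$ for each use of $O_g$ (checks included), is at most $$c_q\left(5\left\lceil\frac{\ln(1/\epsilon)}{2\ln(4/3)}\right\rceil+\pi\sqrt{|L|}\,\sqrt{\left\lceil\frac{\ln(1/\epsilon)}{2\ln(4/3)}\right\rceil}\right),$$ with the ceiling again read as $0$ if $\epsilon\ge1$. -/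

import Mathlib

namespace ZalkaSearch

noncomputable section

/-! ### Quantum query circuits with an oracle for `g : L → Bool` -/

/-- Pure states of a list-index register with basis `L`, a workspace register with basis `W`,
and one answer qubit for the oracle. -/
abbrev State (L W : Type*) [Fintype L] [Fintype W] := EuclideanSpace ℂ (L × W × Bool)

/-- The action of the oracle on basis labels, `(x, w, b) ↦ (x, w, b ⊕ g x)`. -/
def oraclePerm {L W : Type*} (g : L → Bool) : Equiv.Perm (L × W × Bool) where
  toFun i := (i.1, i.2.1, xor i.2.2 (g i.1))
  invFun i := (i.1, i.2.1, xor i.2.2 (g i.1))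
  left_inv i := by simp
  right_inv i := by simp

/-- The oracle `O_g |x⟩|w⟩|b⟩ = |x⟩|w⟩|b ⊕ g x⟩` (see `oracle_single`). -/
def oracle {L W : Type*} [Fintype L] [Fintype W] (g : L → Bool) :
    State L W ≃ₗᵢ[ℂ] State L W :=
  LinearIsometryEquiv.piLpCongrLeft 2 ℂ ℂ (oraclePerm g)

theorem oracle_single {L W : Type*} [Fintype L] [Fintype W] [DecidableEq L] [DecidableEq W]
    (g : L → Bool) (x : L) (w : W) (b : Bool) :
    oracle g (EuclideanSpace.single (x, w, b) 1) =
      EuclideanSpace.single (x, w, xor b (g x)) 1 := by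
  simp only [oracle, EuclideanSpace.single]
  exact LinearIsometryEquiv.piLpCongrLeft_single (p := 2) (𝕜 := ℂ) (E := ℂ)
    (oraclePerm g) (x, w, b) 1

/-- A gate is a unitary (which does not see `g`) or one use of the oracle. -/
inductive Gate (L W : Type*) [Fintype L] [Fintype W] where
  | unitary (U : State L W ≃ₗᵢ[ℂ] State L W) : Gate L W
  | query : Gate L W

def Gate.toIso {L W : Type*} [Fintype L] [Fintype W] (g : L → Bool) :
    Gate L W → (State L W ≃ₗᵢ[ℂ] State L W)
  | .unitary U => U
  | .query => oracle g

/-- The number of uses of the oracle. -/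
def Gate.queries {L W : Type*} [Fintype L] [Fintype W] : Gate L W → ℕ
  | .unitary _ => 0
  | .query => 1

/-- A query circuit: a normalised start state (which does not depend on `g`) and a list of gates,
applied from left to right. -/
structure Circuit (L W : Type*) [Fintype L] [Fintype W] where
  init : State L W
  norm_init : ‖init‖ = 1
  gates : List (Gate L W)

namespace Circuit

variable {L W : Type*} [Fintype L] [Fintype W]

/-- The number of oracle gates. -/
def queries (C : Circuit L W) : ℕ := (C.gates.map Gate.queries).sum

/-- The final state of the circuit. -/
def final (g : L → Bool) (C : Circuit L W) : State L W :=
  C.gates.foldl (fun φ G => G.toIso g φ) C.init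

theorem norm_final (g : L → Bool) (C : Circuit L W) : ‖C.final g‖ = 1 := by
  have h : ∀ (l : List (Gate L W)) (φ : State L W),
      ‖l.foldl (fun φ G => G.toIso g φ) φ‖ = ‖φ‖ := by
    intro l
    induction l with
    | nil => intro φ; rfl
    | cons G l ih => intro φ; rw [List.foldl_cons, ih, LinearIsometryEquiv.norm_map]
  rw [final, h, C.norm_init]

/-- The distribution of the outcome when the list-index register of the final state is measured
in the computational basis (Born rule). -/
def outcome (g : L → Bool) (C : Circuit L W) : PMF L :=
  PMF.ofFintype (fun x => ENNReal.ofReal (∑ i : W × Bool, ‖C.final g (x, i)‖ ^ 2)) (by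
    rw [← ENNReal.ofReal_sum_of_nonneg (fun x _ => Finset.sum_nonneg fun i _ => sq_nonneg _),
      ← Fintype.sum_prod_type', ← EuclideanSpace.norm_sq_eq, C.norm_final]
    simp)

end Circuit

/-! ### Randomised, adaptive search programs -/

/-- A search program. It has no access to `g` other than oracle gates in circuits and checks. -/
inductive Program (L : Type*) [Fintype L] : Type _ where
  /-- Stop and return an item, or report that there is no marked item. -/
  | output (r : Option L) : Program L
  /-- Choose `j ∈ {0, …, n}` uniformly at random and continue. -/
  | sample (n : ℕ) (next : Fin (n + 1) → Program L) : Program L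
  /-- Run a circuit, measure the list index, and continue. -/
  | measure (W : Type) [Fintype W] (C : Circuit L W) (next : L → Program L) : Program L
  /-- Apply the oracle once to `|x⟩|0⟩`, read off `g x`, and continue. -/
  | check (x : L) (next : Bool → Program L) : Program L

/-- The joint law of the returned answer and of the number of queries to `g`, when each use of
the oracle costs `cq` queries to `g`. -/
def Program.exec {L : Type*} [Fintype L] (cq : ℕ) (g : L → Bool) :
    Program L → PMF (Option L × ℕ)
  | .output r => PMF.pure (r, 0)
  | .sample n next => (PMF.uniformOfFintype (Fin (n + 1))).bind fun j => (next j).exec cq g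
  | @Program.measure _ _ _ _ C next => (C.outcome g).bind fun x =>
      ((next x).exec cq g).map fun o => (o.1, cq * C.queries + o.2)
  | .check x next => ((next (g x)).exec cq g).map fun o => (o.1, cq + o.2)

/-- Run a circuit, measure, and check the outcome with one use of the oracle. If it is marked,
return it and stop; otherwise go on with `rest`. -/
def Program.attempt {L : Type*} [Fintype L] {W : Type} [Fintype W] (C : Circuit L W)
    (rest : Program L) : Program L :=
  .measure W C fun x => .check x fun b => if b then .output (some x) else rest

/-! ### Grover search and exact Grover search -/

/-- The circuit that starts in `ψ` and applies `j` Grover iterations. One iteration is a use of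
the oracle, followed by the reflection `2|ψ⟩⟨ψ| - 1`. -/
def iterate {L W : Type*} [Fintype L] [Fintype W] (ψ : State L W) (hψ : ‖ψ‖ = 1) (j : ℕ) :
    Circuit L W where
  init := ψ
  norm_init := hψ
  gates := (List.replicate j [.query, .unitary (ℂ ∙ ψ).reflection]).flatten

/-- The uniform superposition of all items, with the answer qubit in `(|0⟩ - |1⟩) / √2`, so that
the oracle multiplies `|x⟩` by `(-1) ^ (g x)`. -/
def uniformState (L : Type*) [Fintype L] : State L Unit :=
  WithLp.toLp 2 fun i => (((if i.2.2 then -1 else 1) / √(2 * Fintype.card L) : ℝ) : ℂ)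

/-- The uniform superposition of all items together with a workspace qubit in the state
`sin φ |1⟩ + cos φ |0⟩`. The answer qubit is `(|0⟩ - |1⟩) / √2` where the workspace qubit is `|1⟩`
and `(|0⟩ + |1⟩) / √2` where it is `|0⟩`, so that the oracle flips the sign exactly on the part in
which the item is marked and the workspace qubit is `|1⟩`. -/
def dampedState (L : Type*) [Fintype L] (φ : ℝ) : State L Bool :=
  WithLp.toLp 2 fun i => (((if i.2.1 then Real.sin φ else Real.cos φ) *
    (if i.2.1 && i.2.2 then -1 else 1) / √(2 * Fintype.card L) : ℝ) : ℂ)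

theorem norm_uniformState (L : Type*) [Fintype L] [Nonempty L] : ‖uniformState L‖ = 1 := by
  have hN : (0 : ℝ) < Fintype.card L := by exact_mod_cast Fintype.card_pos
  have h : ‖uniformState L‖ ^ 2 = 1 := by
    rw [EuclideanSpace.norm_sq_eq, Fintype.sum_prod_type]
    simp only [uniformState, Complex.norm_real, Real.norm_eq_abs, sq_abs, div_pow,
      Real.sq_sqrt (show (0 : ℝ) ≤ 2 * Fintype.card L by positivity), Fintype.sum_prod_type]
    simp
    field_simp
  exact (pow_eq_one_iff_of_nonneg (norm_nonneg _) two_ne_zero).1 h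

theorem norm_dampedState (L : Type*) [Fintype L] [Nonempty L] (φ : ℝ) :
    ‖dampedState L φ‖ = 1 := by
  have hN : (0 : ℝ) < Fintype.card L := by exact_mod_cast Fintype.card_pos
  have h : ‖dampedState L φ‖ ^ 2 = 1 := by
    rw [EuclideanSpace.norm_sq_eq, Fintype.sum_prod_type]
    simp only [dampedState, Complex.norm_real, Real.norm_eq_abs, sq_abs, div_pow, mul_pow,
      Real.sq_sqrt (show (0 : ℝ) ≤ 2 * Fintype.card L by positivity), Fintype.sum_prod_type]
    simp
    field_simp
    linarith [Real.sin_sq_add_cos_sq φ]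
  exact (pow_eq_one_iff_of_nonneg (norm_nonneg _) two_ne_zero).1 h

/-- Grover search with `j` iterations. -/
def grover (L : Type*) [Fintype L] [Nonempty L] (j : ℕ) : Circuit L Unit :=
  iterate (uniformState L) (norm_uniformState L) j

/-- The number of iterations of exact Grover search for `t` marked items,
`⌈(π / 4) √(|L| / t) - 1 / 2⌉`. -/
def exactIterations (L : Type*) [Fintype L] (t : ℕ) : ℕ :=
  ⌈Real.pi / 4 * √(Fintype.card L / t) - 1 / 2⌉₊

/-- Exact Grover search for `t` marked items: with `k` iterations, the workspace qubit is chosen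
such that the part of the start state in which the item is marked and the workspace qubit is `|1⟩`
has norm `√(t / |L|) * sin φ = sin (π / (2 (2 k + 1)))` when there are exactly `t` marked items. -/
def exactGrover (L : Type*) [Fintype L] [Nonempty L] (t : ℕ) : Circuit L Bool :=
  let φ : ℝ := Real.arcsin (√(Fintype.card L / t) *
    Real.sin (Real.pi / (2 * (2 * exactIterations L t + 1))))
  iterate (dampedState L φ) (norm_dampedState L φ) (exactIterations L t)

/-! ### The search algorithm -/

/-- `n` times: choose `j ∈ {0, …, m}` uniformly at random and attempt Grover search with `j`
iterations. If no marked item is found, report that there is none. -/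
def randomPhase (L : Type*) [Fintype L] [Nonempty L] (m : ℕ) : ℕ → Program L
  | 0 => .output none
  | n + 1 => .sample m fun j => .attempt (grover L j) (randomPhase L m n)

/-- Attempt exact Grover search for `t = 1, …, t₀`, then continue with `rest`. -/
def exactPhase (L : Type*) [Fintype L] [Nonempty L] (t₀ : ℕ) (rest : Program L) : Program L :=
  (List.range' 1 t₀).foldr (fun t p => .attempt (exactGrover L t) p) rest

/-- The threshold `t₀ = ⌈ln ε / (2 ln (3 / 4))⌉` (zero if `ε ≥ 1`). -/
def threshold (ε : ℝ) : ℕ := ⌈Real.log ε / (2 * Real.log (3 / 4))⌉₊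

/-- The algorithm with target failure probability `ε`. -/
def qsearch (L : Type*) [Fintype L] [Nonempty L] (ε : ℝ) : Program L :=
  exactPhase L (threshold ε)
    (randomPhase L ⌈Real.pi / 4 * √(Fintype.card L / threshold ε)⌉₊ (2 * threshold ε))

/-- A correct answer: a marked item, or "none" when there is no marked item. -/
def Correct {L : Type*} (g : L → Bool) : Option L → Prop
  | some x => g x = true
  | none => ∀ x, g x = false

end

end ZalkaSearch

/-!
Write `N` for the number of items, `M` for the number of marked ones and `T` for the threshold.

*Failure probability.* A returned item has been checked, so the only possible error is to report
that there is no marked item although `M > 0`. The failure probabilities of successive runs multiply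
(`failProb_attempt`), so each run enters only through the probability that it misses. In a run the
start state splits as `G + B`, where the oracle negates `G` and fixes `B`; with `‖G‖ = sin θ`, one
iteration rotates by `2 θ` in the plane of `G` and `B`, and after `j` iterations the run misses with
probability at most `cos² ((2 j + 1) θ)` (`exists_iterate_reflection_comp`, `missProb_iterate_le`).
* If `1 ≤ M ≤ T`, the exact run for `t = M` has `(2 k + 1) θ = π / 2` and never misses
  (`missProb_exactGrover_eq_zero`).
* If `M > T ≥ 1`, then `sin² θ = M / N` exceeds `T / N`, and the mean of `cos² ((2 j + 1) θ)` over
  the random `j` is at most `3 / 4` (`sum_cos_sq_odd_mul_le`). This needs no upper bound on `M`: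
  when `2 θ` is close to `π`, the Dirichlet-type sum `∑ cos ((2 j + 1) 2 θ)` is not positive. The
  `2 T` independent runs all miss with probability at most `(3 / 4) ^ (2 T) ≤ ε`.
* If `T = 0`, then `ε ≥ 1` and there is nothing to prove.

*Queries.* With `y = (π / 4) √(N / T)`, the worst case uses the oracle
`3 T + 2 T ⌈y⌉ + ∑_{t ≤ T} k_t` times, and the bound `5 T + 4 y T` leaves no room for estimating
each ceiling in `k_t` by itself. Instead `∑ k_t` is counted in layers: the number of `t ≤ T` with
`k < k_t` is at most `T`, and at most `T y² / (k + 1/2)²`. Taking the first bound for `n` layers and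
telescoping the second gives `∑ k_t ≤ T (n + y² / n)`, which suffices for a suitable `n`
(`sum_add_ceil_le`).
-/

namespace ZalkaSearch

/-! ### Grover iterations as rotations -/

section Rotation

variable {E : Type*} [NormedAddCommGroup E] [InnerProductSpace ℂ E]

/-- The Grover iteration in the plane spanned by the good part `G` and the bad part `B` of the start
state. Stating the coefficients through `a * sin θ` and `b * cos θ` avoids dividing by `sin θ` or
`cos θ`, either of which may vanish. -/
theorem exists_iterate_reflection_comp (O : E ≃ₗᵢ[ℂ] E) {G B : E} (hG : O G = -G) (hB : O B = B)
    {θ : ℝ} (hGθ : ‖G‖ ^ 2 = Real.sin θ ^ 2) (hBθ : ‖B‖ ^ 2 = Real.cos θ ^ 2) (j : ℕ) :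
    ∃ a b : ℝ, a * Real.sin θ = Real.sin ((2 * j + 1) * θ) ∧
      b * Real.cos θ = Real.cos ((2 * j + 1) * θ) ∧
      (fun φ => (ℂ ∙ (G + B)).reflection (O φ))^[j] (G + B) = (a : ℂ) • G + (b : ℂ) • B := by
  have hGB : inner ℂ G B = 0 := by
    have h := O.inner_map_map G B
    rw [hG, hB, inner_neg_left] at h
    exact self_eq_neg.1 h.symm
  have hBG : inner ℂ B G = 0 := inner_eq_zero_symm.1 hGB
  have hGG : inner ℂ G G = ((Real.sin θ ^ 2 : ℝ) : ℂ) := by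
    rw [inner_self_eq_norm_sq_to_K, ← hGθ]; norm_cast
  have hBB : inner ℂ B B = ((Real.cos θ ^ 2 : ℝ) : ℂ) := by
    rw [inner_self_eq_norm_sq_to_K, ← hBθ]; norm_cast
  have hnorm : ‖G + B‖ = 1 := by
    have h := norm_add_sq_eq_norm_sq_add_norm_sq_of_inner_eq_zero G B hGB
    have : ‖G + B‖ ^ 2 = 1 := by nlinarith [Real.sin_sq_add_cos_sq θ]
    exact (pow_eq_one_iff_of_nonneg (norm_nonneg _) two_ne_zero).1 this
  induction j with
  | zero => exact ⟨1, 1, by simp, by simp, by simp⟩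
  | succ j ih =>
    obtain ⟨a, b, ha, hb, h⟩ := ih
    refine ⟨2 * (b * Real.cos θ ^ 2 - a * Real.sin θ ^ 2) + a,
      2 * (b * Real.cos θ ^ 2 - a * Real.sin θ ^ 2) - b, ?_, ?_, ?_⟩
    · rw [show (2 * ((j + 1 : ℕ) : ℝ) + 1) * θ = (2 * j + 1) * θ + 2 * θ by push_cast; ring,
        Real.sin_add, ← ha, ← hb, Real.sin_two_mul, Real.cos_two_mul']
      linear_combination (-(a * Real.sin θ)) * Real.sin_sq_add_cos_sq θ
    · rw [show (2 * ((j + 1 : ℕ) : ℝ) + 1) * θ = (2 * j + 1) * θ + 2 * θ by push_cast; ring,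
        Real.cos_add, ← ha, ← hb, Real.sin_two_mul, Real.cos_two_mul']
      linear_combination (b * Real.cos θ) * Real.sin_sq_add_cos_sq θ
    · rw [Function.iterate_succ_apply', h, Submodule.reflection_apply,
        Submodule.starProjection_unit_singleton ℂ hnorm, map_add, map_smul, map_smul, hG, hB]
      simp only [inner_add_left, inner_add_right, inner_smul_right, inner_neg_right, hGB, hBG,
        hGG, hBB]
      push_cast
      module

end Rotation

section Circuits

variable {L W : Type*} [Fintype L] [Fintype W]

theorem oracle_apply (g : L → Bool) (φ : State L W) (x : L) (w : W) (b : Bool) :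
    oracle g φ (x, w, b) = φ (x, w, xor b (g x)) := rfl

theorem final_iterate (g : L → Bool) {ψ : State L W} (hψ : ‖ψ‖ = 1) (j : ℕ) :
    (iterate ψ hψ j).final g = (fun φ => (ℂ ∙ ψ).reflection (oracle g φ))^[j] ψ := by
  induction j with
  | zero => rfl
  | succ j ih =>
    rw [Function.iterate_succ_apply', ← ih]
    simp [Circuit.final, iterate, List.replicate_succ', Gate.toIso, -List.append_eq]

theorem queries_iterate {ψ : State L W} (hψ : ‖ψ‖ = 1) (j : ℕ) :
    (iterate ψ hψ j).queries = j := by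
  induction j with
  | zero => rfl
  | succ j ih =>
    simp only [Circuit.queries, iterate] at ih ⊢
    simp [List.replicate_succ, Gate.queries] at ih ⊢
    omega

/-- The weight of the good basis states after `j` Grover iterations, for a set `S` of good states
on which the oracle acts as a sign flip and off which it acts trivially. -/
theorem sum_norm_sq_final_iterate (g : L → Bool) {ψ : State L W} (hψ : ‖ψ‖ = 1)
    (S : L → W → Bool) (hflip : ∀ x w b, S x w → ψ (x, w, xor b (g x)) = -ψ (x, w, b))
    (hfix : ∀ x w b, S x w = false → ψ (x, w, xor b (g x)) = ψ (x, w, b)) {θ : ℝ}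
    (hθ : (∑ i, if S i.1 i.2.1 then ‖ψ i‖ ^ 2 else 0) = Real.sin θ ^ 2) (j : ℕ) :
    (∑ i, if S i.1 i.2.1 then ‖(iterate ψ hψ j).final g i‖ ^ 2 else 0) =
      Real.sin ((2 * j + 1) * θ) ^ 2 := by
  set G : State L W := WithLp.toLp 2 fun i => if S i.1 i.2.1 then ψ i else 0 with hGdef
  set B : State L W := WithLp.toLp 2 fun i => if S i.1 i.2.1 then 0 else ψ i with hBdef
  have hGB : G + B = ψ := by
    ext i
    by_cases h : S i.1 i.2.1 <;> simp [hGdef, hBdef, h]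
  have hG : oracle g G = -G := by
    ext ⟨x, w, b⟩
    rw [oracle_apply]
    by_cases h : S x w
    · simp [hGdef, h, hflip x w b h]
    · simp [hGdef, h]
  have hB : oracle g B = B := by
    ext ⟨x, w, b⟩
    rw [oracle_apply]
    by_cases h : S x w
    · simp [hBdef, h]
    · simp [hBdef, h, hfix x w b (by simpa using h)]
  have hGn : ‖G‖ ^ 2 = Real.sin θ ^ 2 := by
    rw [← hθ, EuclideanSpace.norm_sq_eq]
    refine Finset.sum_congr rfl fun i _ => ?_
    by_cases h : S i.1 i.2.1 <;> simp [hGdef, h]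
  have hsum : ‖G‖ ^ 2 + ‖B‖ ^ 2 = 1 := by
    rw [← one_pow 2, ← hψ, EuclideanSpace.norm_sq_eq, EuclideanSpace.norm_sq_eq,
      EuclideanSpace.norm_sq_eq, ← Finset.sum_add_distrib]
    refine Finset.sum_congr rfl fun i _ => ?_
    by_cases h : S i.1 i.2.1 <;> simp [hGdef, hBdef, h]
  have hBn : ‖B‖ ^ 2 = Real.cos θ ^ 2 := by linarith [Real.sin_sq_add_cos_sq θ]
  obtain ⟨a, b, ha, -, h⟩ := exists_iterate_reflection_comp (oracle g) hG hB hGn hBn j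
  rw [hGB] at h
  rw [final_iterate, h, ← ha, mul_pow, ← hθ, Finset.mul_sum]
  refine Finset.sum_congr rfl fun i _ => ?_
  by_cases h : S i.1 i.2.1 <;> simp [hGdef, hBdef, h, mul_pow]

/-- The probability that the measured item is not marked. -/
noncomputable def missProb (g : L → Bool) (C : Circuit L W) : ENNReal :=
  (C.outcome g).toOuterMeasure {x | g x = false}

theorem missProb_le_one (g : L → Bool) (C : Circuit L W) : missProb g C ≤ 1 := by
  refine ((C.outcome g).toOuterMeasure.mono (Set.subset_univ _)).trans_eq ?_
  exact ((C.outcome g).toOuterMeasure_apply_eq_one_iff _).2 (Set.subset_univ _)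

/-- If all good basis states carry a marked item, then the missing probability is at most the
weight of the other basis states. -/
theorem missProb_iterate_le (g : L → Bool) {ψ : State L W} (hψ : ‖ψ‖ = 1)
    (S : L → W → Bool) (hS : ∀ x w, S x w → g x)
    (hflip : ∀ x w b, S x w → ψ (x, w, xor b (g x)) = -ψ (x, w, b))
    (hfix : ∀ x w b, S x w = false → ψ (x, w, xor b (g x)) = ψ (x, w, b)) {θ : ℝ}
    (hθ : (∑ i, if S i.1 i.2.1 then ‖ψ i‖ ^ 2 else 0) = Real.sin θ ^ 2) (j : ℕ) :
    missProb g (iterate ψ hψ j) ≤ ENNReal.ofReal (Real.cos ((2 * j + 1) * θ) ^ 2) := by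
  have hgood := sum_norm_sq_final_iterate g hψ S hflip hfix hθ j
  set φ := (iterate ψ hψ j).final g with hφ
  have hone : ∑ i, ‖φ i‖ ^ 2 = 1 := by
    rw [← EuclideanSpace.norm_sq_eq, hφ, Circuit.norm_final, one_pow]
  have hmiss : missProb g (iterate ψ hψ j) =
      ENNReal.ofReal (∑ i : L × W × Bool, if g i.1 then 0 else ‖φ i‖ ^ 2) := by
    rw [missProb, PMF.toOuterMeasure_apply_fintype, Fintype.sum_prod_type,
      ENNReal.ofReal_sum_of_nonneg fun x _ => Finset.sum_nonneg fun i _ => by positivity]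
    refine Finset.sum_congr rfl fun x _ => ?_
    cases hx : g x <;> simp [Set.indicator, hx, Circuit.outcome, hφ]
  rw [hmiss]
  refine ENNReal.ofReal_le_ofReal ?_
  have : (∑ i : L × W × Bool, if g i.1 then 0 else ‖φ i‖ ^ 2) ≤
      ∑ i, (‖φ i‖ ^ 2 - if S i.1 i.2.1 then ‖φ i‖ ^ 2 else 0) := by
    refine Finset.sum_le_sum fun i _ => ?_
    cases hs : S i.1 i.2.1
    · cases g i.1 <;> simp
    · simp [hS _ _ hs]
  rw [Finset.sum_sub_distrib, hone, hgood] at this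
  linarith [Real.sin_sq_add_cos_sq ((2 * j + 1) * θ)]

end Circuits

section Grover

variable {L : Type*} [Fintype L] [Nonempty L]

theorem norm_uniformState_apply_sq (i : L × Unit × Bool) :
    ‖uniformState L i‖ ^ 2 = 1 / (2 * Fintype.card L) := by
  have h : (0 : ℝ) ≤ 2 * Fintype.card L := by positivity
  simp only [uniformState, Complex.norm_real, Real.norm_eq_abs, sq_abs, div_pow, Real.sq_sqrt h]
  split_ifs <;> simp

theorem missProb_grover_le (g : L → Bool) {θ : ℝ}
    (hθ : Real.sin θ ^ 2 = (Finset.univ.filter fun x => g x).card / Fintype.card L) (j : ℕ) :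
    missProb g (grover L j) ≤ ENNReal.ofReal (Real.cos ((2 * j + 1) * θ) ^ 2) := by
  refine missProb_iterate_le g _ (fun x _ => g x) (fun x _ h => h) ?_ ?_ ?_ j
  · intro x w b h
    cases b <;> simp [uniformState, h, neg_div]
  · intro x w b h
    simp only [h, Bool.xor_false]
  · have hN : (Fintype.card L : ℝ) ≠ 0 := by exact_mod_cast Fintype.card_ne_zero
    simp only [norm_uniformState_apply_sq, hθ, Fintype.sum_prod_type]
    simp [← Finset.sum_filter]
    field_simp

/-- Damping the marked amplitude by `sin φ` turns the initial angle into the unit fraction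
`π / (2 (2 k + 1))` of a right angle, so that `k` iterations end exactly on the good states. -/
theorem missProb_exactGrover_eq_zero (g : L → Bool) {t : ℕ} (ht : 0 < t)
    (hcard : (Finset.univ.filter fun x => g x).card = t) :
    missProb g (exactGrover L t) = 0 := by
  have hN : (0 : ℝ) < Fintype.card L := by exact_mod_cast Fintype.card_pos
  have ht' : (0 : ℝ) < t := by exact_mod_cast ht
  set k := exactIterations L t with hk
  set θ : ℝ := Real.pi / (2 * (2 * k + 1)) with hθ
  set r : ℝ := √(Fintype.card L / t) with hr
  have hr0 : 0 < r := Real.sqrt_pos.2 (by positivity)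
  have hθ0 : 0 < θ := by have := Real.pi_pos; positivity
  have hrθ : r * θ ≤ 1 := by
    have h := Nat.le_ceil (Real.pi / 4 * r - 1 / 2)
    have h' : Real.pi / 4 * r - 1 / 2 ≤ k := h
    rw [hθ, mul_div_assoc', div_le_one (by positivity)]
    linarith
  have hθπ : θ ≤ Real.pi := by
    rw [hθ, div_le_iff₀ (by positivity)]
    nlinarith [Real.pi_pos, (Nat.cast_nonneg k : (0 : ℝ) ≤ k)]
  have hsin0 : 0 ≤ Real.sin θ := Real.sin_nonneg_of_nonneg_of_le_pi hθ0.le hθπ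
  have hφ : Real.sin (Real.arcsin (r * Real.sin θ)) = r * Real.sin θ := by
    refine Real.sin_arcsin ?_ ?_
    · linarith [mul_nonneg hr0.le hsin0]
    · exact (mul_le_mul_of_nonneg_left (Real.sin_le hθ0.le) hr0.le).trans hrθ
  have h := missProb_iterate_le g
    (norm_dampedState L (Real.arcsin (r * Real.sin θ))) (fun x w => g x && w)
    (fun x w h => by simp only [Bool.and_eq_true] at h; exact h.1) ?_ ?_ (θ := θ) ?_ k
  · rw [show (2 * (k : ℝ) + 1) * θ = Real.pi / 2 by rw [hθ]; field_simp, Real.cos_pi_div_two] at h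
    have h0 : missProb g (iterate _ (norm_dampedState L (Real.arcsin (r * Real.sin θ))) k) = 0 := by
      simpa using h
    exact h0
  · intro x w b h
    simp only [Bool.and_eq_true] at h
    cases b <;> simp [dampedState, h.1, h.2, neg_div]
  · intro x w b h
    cases w
    · simp [dampedState]
    · simp only [Bool.and_true] at h
      simp [h]
  · have h2 : (0 : ℝ) ≤ 2 * Fintype.card L := by positivity
    have hr2 : r ^ 2 = Fintype.card L / t := Real.sq_sqrt (by positivity)
    simp only [dampedState, Complex.norm_real, Real.norm_eq_abs, sq_abs, div_pow, mul_pow,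
      Real.sq_sqrt h2, Fintype.sum_prod_type, Fintype.sum_bool, hφ]
    simp [Finset.sum_add_distrib, ← Finset.sum_filter, hcard, mul_pow, hr2]
    field_simp
    ring

end Grover

/-! ### Failure probability and query count of programs -/

section Programs

variable {L : Type*} [Fintype L]

/-- The probability that a program returns a wrong answer. -/
noncomputable def failProb (cq : ℕ) (g : L → Bool) (p : Program L) : ENNReal :=
  (p.exec cq g).toOuterMeasure {o | ¬ Correct g o.1}

theorem failProb_le_one (cq : ℕ) (g : L → Bool) (p : Program L) : failProb cq g p ≤ 1 := by
  refine ((p.exec cq g).toOuterMeasure.mono (Set.subset_univ _)).trans_eq ?_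
  exact ((p.exec cq g).toOuterMeasure_apply_eq_one_iff _).2 (Set.subset_univ _)

theorem failProb_output_none {cq : ℕ} {g : L → Bool} (hg : ∀ x, g x = false) :
    failProb cq g (.output none) = 0 := by
  simp only [failProb, Program.exec, PMF.toOuterMeasure_pure_apply]
  exact if_neg fun h => h hg

/-- A found item is always marked, so an attempt fails exactly if it misses and the remaining
program fails. -/
theorem failProb_attempt (cq : ℕ) (g : L → Bool) {W : Type} [Fintype W] (C : Circuit L W)
    (rest : Program L) :
    failProb cq g (.attempt C rest) = missProb g C * failProb cq g rest := by
  simp only [failProb, missProb, Program.attempt, Program.exec, PMF.toOuterMeasure_bind_apply,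
    PMF.toOuterMeasure_map_apply, Set.preimage_ofPred_eq, PMF.toOuterMeasure_apply_fintype,
    tsum_fintype, Finset.sum_mul]
  refine Finset.sum_congr rfl fun x _ => ?_
  cases hx : g x
  · simp [Set.indicator, hx]
  · simp [Set.indicator, hx, Program.exec, PMF.toOuterMeasure_pure_apply, Correct]

theorem failProb_randomPhase [Nonempty L] (cq : ℕ) (g : L → Bool) (m n : ℕ) :
    failProb cq g (randomPhase L m n) =
      (∑ j : Fin (m + 1), ((m + 1 : ℕ) : ENNReal)⁻¹ * missProb g (grover L j)) ^ n *
        failProb cq g (.output none) := by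
  induction n with
  | zero => simp [randomPhase]
  | succ n ih =>
    have h : failProb cq g (randomPhase L m (n + 1)) =
        ∑ j : Fin (m + 1), ((m + 1 : ℕ) : ENNReal)⁻¹ *
          failProb cq g (.attempt (grover L j) (randomPhase L m n)) := by
      simp only [failProb, randomPhase, Program.exec, PMF.toOuterMeasure_bind_apply,
        tsum_fintype, PMF.uniformOfFintype_apply, Fintype.card_fin]
    simp only [h, failProb_attempt, ih, pow_succ', Finset.sum_mul, mul_assoc]

theorem failProb_foldr_attempt_le [Nonempty L] (cq : ℕ) (g : L → Bool) (l : List ℕ)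
    (rest : Program L) :
    failProb cq g (l.foldr (fun t p => .attempt (exactGrover L t) p) rest) ≤
      failProb cq g rest := by
  induction l with
  | nil => exact le_rfl
  | cons t l ih =>
    rw [List.foldr_cons, failProb_attempt]
    exact (mul_le_of_le_one_left' (missProb_le_one _ _)).trans ih

theorem failProb_foldr_attempt_eq_zero [Nonempty L] (cq : ℕ) (g : L → Bool) {l : List ℕ} {t : ℕ}
    (ht : t ∈ l) (h : missProb g (exactGrover L t) = 0) (rest : Program L) :
    failProb cq g (l.foldr (fun t p => .attempt (exactGrover L t) p) rest) = 0 := by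
  induction l with
  | nil => simp at ht
  | cons s l ih =>
    rw [List.foldr_cons, failProb_attempt]
    rcases List.mem_cons.1 ht with rfl | ht
    · rw [h, zero_mul]
    · rw [ih ht, mul_zero]

/-- In every execution the cost in queries to `g` is at most that of `n` uses of the oracle. -/
def UsesAtMost (cq : ℕ) (g : L → Bool) (p : Program L) (n : ℕ) : Prop :=
  ∀ o ∈ (p.exec cq g).support, o.2 ≤ cq * n

theorem usesAtMost_attempt {cq : ℕ} {g : L → Bool} {W : Type} [Fintype W] (C : Circuit L W)
    {rest : Program L} {n : ℕ} (h : UsesAtMost cq g rest n) :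
    UsesAtMost cq g (.attempt C rest) (C.queries + 1 + n) := by
  intro o ho
  simp only [Program.attempt, Program.exec, PMF.mem_support_bind_iff,
    PMF.mem_support_map_iff] at ho
  obtain ⟨x, -, _, ⟨o', ho', rfl⟩, rfl⟩ := ho
  have h' : o'.2 ≤ cq * n := by
    cases hx : g x
    · exact h o' (by simpa [hx] using ho')
    · simp [hx, Program.exec] at ho'
      simp [ho']
  simp only [mul_add, mul_one]
  omega

theorem usesAtMost_randomPhase [Nonempty L] (cq : ℕ) (g : L → Bool) (m n : ℕ) :
    UsesAtMost cq g (randomPhase L m n) (n * (m + 1)) := by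
  induction n with
  | zero => intro o ho; simp [randomPhase, Program.exec] at ho; simp [ho]
  | succ n ih =>
    intro o ho
    simp only [randomPhase, Program.exec, PMF.mem_support_bind_iff] at ho
    obtain ⟨j, -, ho⟩ := ho
    refine (usesAtMost_attempt (grover L j) ih o ho).trans (Nat.mul_le_mul_left _ ?_)
    rw [grover, queries_iterate, Nat.succ_mul]
    have := j.2
    omega

theorem usesAtMost_exactPhase [Nonempty L] {cq : ℕ} {g : L → Bool} {rest : Program L} {n : ℕ}
    (h : UsesAtMost cq g rest n) (T : ℕ) :
    UsesAtMost cq g (exactPhase L T rest)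
      (∑ t ∈ Finset.range T, (exactIterations L (t + 1) + 1) + n) := by
  have hl : ∀ l : List ℕ, UsesAtMost cq g (l.foldr (fun t p => .attempt (exactGrover L t) p) rest)
      ((l.map fun t => exactIterations L t + 1).sum + n) := by
    intro l
    induction l with
    | nil => simpa using h
    | cons t l ih =>
      have := usesAtMost_attempt (exactGrover L t) ih
      rwa [exactGrover, queries_iterate, ← add_assoc, ← List.sum_cons] at this
  have hsum : ((List.range' 1 T).map fun t => exactIterations L t + 1).sum =
      ∑ t ∈ Finset.range T, (exactIterations L (t + 1) + 1) := by
    induction T with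
    | zero => rfl
    | succ T ih =>
      rw [List.range'_1_concat, List.map_append, List.sum_append, ih, Finset.sum_range_succ,
        add_comm 1 T]
      simp
  rw [← hsum]
  exact hl _

end Programs

/-! ### Summing the numbers of iterations -/

section Counting

/-- Double counting: `∑ f` is the sum over `k` of the number of `t` with `k < f t`. -/
theorem sum_eq_sum_card_lt (f : ℕ → ℕ) (T K : ℕ) (hK : ∀ t ∈ Finset.range T, f t ≤ K) :
    ∑ t ∈ Finset.range T, f t =
      ∑ k ∈ Finset.range K, ((Finset.range T).filter fun t => k < f t).card := by
  simp only [Finset.card_filter]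
  rw [Finset.sum_comm]
  refine Finset.sum_congr rfl fun t ht => ?_
  rw [← Finset.card_filter]
  have : (Finset.range K).filter (fun k => k < f t) = Finset.range (f t) := by
    ext k
    have := hK t ht
    simp only [Finset.mem_filter, Finset.mem_range]
    omega
  rw [this, Finset.card_range]

theorem card_filter_succ_le {p : ℕ → Prop} [DecidablePred p] {T : ℕ} {X : ℝ} (hX : 0 ≤ X)
    (h : ∀ t, p t → ((t : ℝ) + 1) ≤ X) : (((Finset.range T).filter p).card : ℝ) ≤ X := by
  have hsub : (Finset.range T).filter p ⊆ Finset.range ⌊X⌋₊ := by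
    intro t ht
    have := Nat.le_floor (by exact_mod_cast h t (Finset.mem_filter.1 ht).2 : ((t + 1 : ℕ) : ℝ) ≤ X)
    exact Finset.mem_range.2 this
  have := Finset.card_le_card hsub
  rw [Finset.card_range] at this
  exact (Nat.cast_le.2 this).trans (Nat.floor_le hX)

/-- If `f t` is at most `√(A / (t + 1)) + 1/2`, then all but `A / n` of the sum of `f` lies in the
first `n` layers `k < f t`. The tail is bounded by `(k + 1/2)² ≥ k (k + 1)` and telescoping. -/
theorem sum_le_sum_layers_add {f : ℕ → ℕ} {A : ℝ} (hA : 0 ≤ A)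
    (hf : ∀ t k : ℕ, k < f t → ((t : ℝ) + 1) * (k + 1 / 2) ^ 2 ≤ A) (T : ℕ) {n : ℕ} (hn : 1 ≤ n) :
    ((∑ t ∈ Finset.range T, f t : ℕ) : ℝ) ≤
      ∑ k ∈ Finset.range n, (((Finset.range T).filter fun t => k < f t).card : ℝ) + A / n := by
  have key : ∀ K, n ≤ K →
      ∑ k ∈ Finset.range K, (((Finset.range T).filter fun t => k < f t).card : ℝ) ≤
      ∑ k ∈ Finset.range n, (((Finset.range T).filter fun t => k < f t).card : ℝ) +
        A * (1 / n - 1 / K) := by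
    intro K hK
    induction K, hK using Nat.le_induction with
    | base => simp
    | succ K hK ih =>
      have hK0 : (0 : ℝ) < K := by exact_mod_cast (by omega : 0 < K)
      have hc : (((Finset.range T).filter fun t => K < f t).card : ℝ) ≤
          A * (1 / K - 1 / (K + 1 : ℕ)) := by
        refine card_filter_succ_le ?_ fun t ht => ?_
        · refine mul_nonneg hA (sub_nonneg.2 ?_)
          push_cast
          gcongr
          linarith
        · have h1 := hf t K ht
          have h2 : (1 : ℝ) / K - 1 / (K + 1 : ℕ) = 1 / (K * (K + 1)) := by
            push_cast
            field_simp
            ring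
          rw [h2, mul_one_div, le_div_iff₀ (by positivity)]
          refine le_trans ?_ h1
          gcongr
          nlinarith
      rw [Finset.sum_range_succ]
      linarith
  have h := key (n + ∑ t ∈ Finset.range T, f t) (Nat.le_add_right _ _)
  rw [sum_eq_sum_card_lt f T (n + ∑ t ∈ Finset.range T, f t) fun t ht =>
    (Finset.single_le_sum (f := f) (fun _ _ => Nat.zero_le _) ht).trans (Nat.le_add_left _ _)]
  push_cast at h ⊢
  refine h.trans ?_
  gcongr
  rw [div_eq_mul_one_div A]
  exact mul_le_mul_of_nonneg_left (sub_le_self _ (by positivity)) hA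

theorem sum_le_mul_add_div {f : ℕ → ℕ} {A : ℝ} (hA : 0 ≤ A)
    (hf : ∀ t k : ℕ, k < f t → ((t : ℝ) + 1) * (k + 1 / 2) ^ 2 ≤ A) (T : ℕ) {n : ℕ} (hn : 1 ≤ n) :
    ((∑ t ∈ Finset.range T, f t : ℕ) : ℝ) ≤ n * T + A / n := by
  refine (sum_le_sum_layers_add hA hf T hn).trans ?_
  gcongr
  have : ∑ k ∈ Finset.range n, (((Finset.range T).filter fun t => k < f t).card : ℝ) ≤
      ∑ _k ∈ Finset.range n, (T : ℝ) := by
    refine Finset.sum_le_sum fun k _ => ?_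
    exact_mod_cast (Finset.card_filter_le _ _).trans_eq (Finset.card_range T)
  simpa using this

theorem sum_le_five_mul {f : ℕ → ℕ} {A : ℝ} (hA : 0 ≤ A)
    (hf : ∀ t k : ℕ, k < f t → ((t : ℝ) + 1) * (k + 1 / 2) ^ 2 ≤ A) (T : ℕ) :
    ((∑ t ∈ Finset.range T, f t : ℕ) : ℝ) ≤ 5 * A := by
  have h := sum_le_sum_layers_add hA hf T le_rfl
  have h0 : (((Finset.range T).filter fun t => 0 < f t).card : ℝ) ≤ 4 * A := by
    refine card_filter_succ_le (by positivity) fun t ht => ?_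
    have := hf t 0 ht
    norm_num at this
    linarith
  simp only [Finset.sum_range_one, Nat.cast_one, div_one] at h
  linarith

/-- With `A = T * y²`, the layer bound with a suitable number of layers. The estimate is tight up
to lower order: for `y` slightly above an integer `n`, the choice of `n` layers bounds the sum by
about `2 * n * T`, which is just what remains after rounding `y` up to `n + 1`. -/
theorem sum_add_ceil_le {f : ℕ → ℕ} {T : ℕ} {y : ℝ} (hy : 0 < y)
    (hf : ∀ t k : ℕ, k < f t → ((t : ℝ) + 1) * (k + 1 / 2) ^ 2 ≤ T * y ^ 2) :
    ((∑ t ∈ Finset.range T, f t : ℕ) : ℝ) + 2 * T * ⌈y⌉₊ ≤ T * (2 + 4 * y) := by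
  have hA : 0 ≤ T * y ^ 2 := by positivity
  have hT : (0 : ℝ) ≤ T := Nat.cast_nonneg T
  have hc := Nat.ceil_lt_add_one hy.le
  have hc1 : 1 ≤ ⌈y⌉₊ := Nat.ceil_pos.2 hy
  obtain ⟨n, hn⟩ : ∃ n, ⌈y⌉₊ = n + 1 := ⟨⌈y⌉₊ - 1, by omega⟩
  have hyn : y ≤ n + 1 := by have := Nat.le_ceil y; rw [hn] at this; exact_mod_cast this
  rw [hn] at hc ⊢
  push_cast at hc ⊢
  rcases Nat.eq_zero_or_pos n with rfl | hn0
  · -- For small `y` the bound `T` on the first layer is too weak; it is replaced by `4 * A`.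
    rcases le_or_gt y (1 / 2) with h | h
    · have h1 := sum_le_five_mul hA hf T
      have h2 : (T : ℝ) * (5 * y ^ 2) ≤ T * (4 * y) := by
        refine mul_le_mul_of_nonneg_left ?_ hT
        nlinarith
      push_cast at h1 ⊢
      linarith
    · have h1 := sum_le_mul_add_div hA hf T le_rfl
      norm_num at hyn
      have h2 : (T : ℝ) * (1 + y ^ 2) ≤ T * (4 * y) := by
        refine mul_le_mul_of_nonneg_left ?_ hT
        nlinarith
      push_cast at h1 ⊢
      linarith
  · have h1 := sum_le_mul_add_div hA hf T hn0
    have hn1 : (1 : ℝ) ≤ n := by exact_mod_cast hn0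
    have h2 : y ^ 2 / n ≤ 4 * y - 3 * n := by
      rw [div_le_iff₀ (by linarith)]
      nlinarith [mul_nonneg (by linarith : 0 ≤ y - n) (by linarith : 0 ≤ 3 * n - y)]
    have h3 := mul_le_mul_of_nonneg_left h2 hT
    rw [mul_div_assoc'] at h3
    push_cast at h1
    linarith

end Counting

section Queries

variable {L : Type*} [Fintype L]

theorem mul_sq_le_of_lt_exactIterations {t k : ℕ} (h : k < exactIterations L (t + 1)) :
    ((t : ℝ) + 1) * (k + 1 / 2) ^ 2 ≤ (Real.pi / 4) ^ 2 * Fintype.card L := by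
  have h1 := Nat.lt_ceil.1 h
  have h2 : (k : ℝ) + 1 / 2 ≤ Real.pi / 4 * √(Fintype.card L / (t + 1 : ℕ)) := by linarith
  have h3 := pow_le_pow_left₀ (by positivity) h2 2
  rw [mul_pow, Real.sq_sqrt (by positivity), mul_div_assoc', le_div_iff₀ (by positivity)] at h3
  push_cast at h3
  linarith

theorem queries_le [Nonempty L] (T : ℕ) :
    ((∑ t ∈ Finset.range T, (exactIterations L (t + 1) + 1) +
      2 * T * (⌈Real.pi / 4 * √(Fintype.card L / T)⌉₊ + 1) : ℕ) : ℝ) ≤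
      5 * T + Real.pi * √(Fintype.card L) * √T := by
  rcases Nat.eq_zero_or_pos T with rfl | hT
  · simp
  have hT' : (0 : ℝ) < T := by exact_mod_cast hT
  have hN : (0 : ℝ) < Fintype.card L := by exact_mod_cast Fintype.card_pos
  have hy : 0 < Real.pi / 4 * √(Fintype.card L / T) := by
    have := Real.pi_pos
    positivity
  have hyT : T * (Real.pi / 4 * √(Fintype.card L / T)) ^ 2 =
      (Real.pi / 4) ^ 2 * Fintype.card L := by
    rw [mul_pow, Real.sq_sqrt (by positivity)]
    field_simp
  have h := sum_add_ceil_le (T := T) (f := fun t => exactIterations L (t + 1)) hy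
    fun t k htk => (mul_sq_le_of_lt_exactIterations htk).trans_eq hyT.symm
  have hs : T * √(Fintype.card L / T) = √(Fintype.card L) * √T := by
    have := Real.mul_self_sqrt hT'.le
    have := (Real.sqrt_pos.2 hT').ne'
    rw [Real.sqrt_div' _ hT'.le]
    field_simp
    nlinarith
  rw [Finset.sum_add_distrib]
  simp only [Finset.sum_const, Finset.card_range, smul_eq_mul, mul_one]
  push_cast at h ⊢
  rw [mul_assoc Real.pi, ← hs]
  linarith

end Queries

/-! ### Averaging over the number of iterations -/

section Averaging

theorem sum_cos_odd_mul (v : ℝ) (n : ℕ) :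
    (∑ j ∈ Finset.range n, Real.cos ((2 * j + 1) * v)) * (2 * Real.sin v) =
      Real.sin (2 * n * v) := by
  induction n with
  | zero => simp
  | succ n ih =>
    rw [Finset.sum_range_succ, add_mul, ih,
      show 2 * n * v = (2 * n + 1) * v - v by ring,
      show 2 * ((n + 1 : ℕ) : ℝ) * v = (2 * n + 1) * v + v by push_cast; ring,
      Real.sin_sub, Real.sin_add]
    ring

/-- If `n * sin v` is at least `1`, the closed form gives the bound. Otherwise `v` is so close to
`π` that `2 * n * (π - v)` is at most `π`, and the sum is not positive. -/
theorem sum_cos_odd_mul_le {v : ℝ} (hv0 : 0 ≤ v) (hv : v ≤ Real.pi) {n : ℕ}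
    (h : v ≤ Real.pi / 2 → 1 ≤ n * Real.sin v) :
    ∑ j ∈ Finset.range n, Real.cos ((2 * j + 1) * v) ≤ n / 2 := by
  have hclosed := sum_cos_odd_mul v n
  have hsin := Real.sin_nonneg_of_nonneg_of_le_pi hv0 hv
  set S := ∑ j ∈ Finset.range n, Real.cos ((2 * j + 1) * v) with hS
  have hn : (0 : ℝ) ≤ n := Nat.cast_nonneg n
  rcases le_or_gt 1 (n * Real.sin v) with h1 | h1
  · have hpos : 0 < Real.sin v := by
      rcases hsin.lt_or_eq with h | h
      · exact h
      · rw [← h] at h1; norm_num at h1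
    by_contra! hlt
    nlinarith [Real.sin_le_one (2 * n * v), mul_lt_mul_of_pos_right hlt hpos]
  · have hvπ : Real.pi / 2 < v := by
      by_contra! hle
      exact absurd (h hle) (not_le.2 h1)
    suffices S ≤ 0 by linarith [div_nonneg hn zero_le_two]
    rcases hsin.lt_or_eq with hpos | hzero
    · have hw := Real.mul_le_sin (x := Real.pi - v) (by linarith) (by linarith)
      rw [Real.sin_pi_sub, div_mul_eq_mul_div, div_le_iff₀ Real.pi_pos] at hw
      have hnw : 2 * n * (Real.pi - v) ≤ Real.pi := by
        nlinarith [mul_le_mul_of_nonneg_left hw hn, Real.pi_pos]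
      have hsn : 0 ≤ Real.sin (2 * n * (Real.pi - v)) :=
        Real.sin_nonneg_of_nonneg_of_le_pi
          (mul_nonneg (by positivity) (by linarith)) hnw
      rw [show 2 * n * (Real.pi - v) = n * (2 * Real.pi) - 2 * n * v by ring,
        Real.sin_nat_mul_two_pi_sub, ← hclosed] at hsn
      by_contra! hlt
      nlinarith [mul_pos hlt hpos]
    · have hv' : v = Real.pi := by
        by_contra hne
        exact absurd (Real.sin_pos_of_pos_of_lt_pi (by linarith [Real.pi_pos])
          (lt_of_le_of_ne hv hne)) (by rw [← hzero]; exact lt_irrefl 0)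
      refine Finset.sum_nonpos fun j _ => ?_
      rw [hv', show (2 * (j : ℝ) + 1) * Real.pi = j * (2 * Real.pi) + Real.pi by ring,
        Real.cos_nat_mul_two_pi_add_pi]
      norm_num

/-- With the number of iterations uniform below `n`, Grover search with initial angle `θ` misses
with probability at most `3 / 4` as soon as `n` is at least of order `1 / sin θ`. -/
theorem sum_cos_sq_odd_mul_le {θ : ℝ} (h0 : 0 ≤ θ) (hθ : θ ≤ Real.pi / 2) {n : ℕ}
    (h : 1 ≤ 2 * (n * Real.sin θ) ^ 2) :
    ∑ j ∈ Finset.range n, Real.cos ((2 * j + 1) * θ) ^ 2 ≤ 3 / 4 * n := by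
  have hle := sum_cos_odd_mul_le (v := 2 * θ) (by linarith) (by linarith) (n := n) fun hv => by
    have hs := Real.sin_nonneg_of_nonneg_of_le_pi (x := 2 * θ) (by linarith) (by linarith)
    have hc := Real.cos_nonneg_of_neg_pi_div_two_le_of_le (x := 2 * θ) (by linarith) hv
    rw [Real.cos_two_mul] at hc
    refine (one_le_sq_iff₀ (mul_nonneg (Nat.cast_nonneg n) hs)).1 ?_
    rw [Real.sin_two_mul]
    nlinarith [mul_nonneg (sq_nonneg ((n : ℝ) * Real.sin θ)) hc]
  have hsq : ∀ j : ℕ, Real.cos ((2 * j + 1) * θ) ^ 2 =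
      1 / 2 + Real.cos ((2 * j + 1) * (2 * θ)) / 2 := by
    intro j
    rw [Real.cos_sq, show 2 * ((2 * (j : ℝ) + 1) * θ) = (2 * j + 1) * (2 * θ) by ring]
  simp only [hsq, Finset.sum_add_distrib, ← Finset.sum_div]
  simp only [Finset.sum_const, Finset.card_range, nsmul_eq_mul]
  linarith

end Averaging

/-! ### Correctness and query bound of the algorithm -/

section Main

variable {L : Type*} [Fintype L] [Nonempty L]

theorem sum_missProb_grover_le (g : L → Bool) {T : ℕ} (hT : 0 < T)
    (hM : T ≤ (Finset.univ.filter fun x => g x).card) {m : ℕ}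
    (hm : Real.pi / 4 * √(Fintype.card L / T) ≤ m) :
    ∑ j : Fin (m + 1), ((m + 1 : ℕ) : ENNReal)⁻¹ * missProb g (grover L j) ≤
      ENNReal.ofReal (3 / 4) := by
  set M := (Finset.univ.filter fun x => g x).card with hMdef
  have hN : (0 : ℝ) < Fintype.card L := by exact_mod_cast Fintype.card_pos
  have hT' : (0 : ℝ) < T := by exact_mod_cast hT
  have hMT : (T : ℝ) ≤ M := by exact_mod_cast hM
  have hMN : (M : ℝ) ≤ Fintype.card L := by exact_mod_cast Finset.card_le_univ _
  set θ := Real.arcsin √(M / Fintype.card L) with hθ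
  have hsinθ : Real.sin θ = √(M / Fintype.card L) :=
    Real.sin_arcsin (by linarith [Real.sqrt_nonneg ((M : ℝ) / Fintype.card L)])
      (Real.sqrt_le_one.2 ((div_le_one hN).2 hMN))
  have hsinθ2 : Real.sin θ ^ 2 = M / Fintype.card L := by
    rw [hsinθ, Real.sq_sqrt (by positivity)]
  have hlarge : 1 ≤ 2 * (((m + 1 : ℕ) : ℝ) * Real.sin θ) ^ 2 := by
    have h1 : Real.pi / 4 * √(Fintype.card L / T) ≤ ((m + 1 : ℕ) : ℝ) := by
      push_cast; linarith
    have h2 := pow_le_pow_left₀ (by have := Real.pi_pos; positivity) h1 2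
    rw [mul_pow, Real.sq_sqrt (by positivity)] at h2
    have h3 : 1 ≤ (Fintype.card L / T : ℝ) * (M / Fintype.card L) := by
      rw [div_mul_div_cancel₀' hN.ne', one_le_div hT']
      exact hMT
    have h4 : 1 / 2 ≤ (Real.pi / 4) ^ 2 := by nlinarith [Real.pi_gt_three]
    rw [mul_pow, hsinθ2]
    have h5 := mul_le_mul_of_nonneg_right h2 (by positivity : (0 : ℝ) ≤ M / Fintype.card L)
    nlinarith
  have hsum := sum_cos_sq_odd_mul_le (Real.arcsin_nonneg.2 (Real.sqrt_nonneg _))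
    (Real.arcsin_le_pi_div_two _) hlarge
  rw [← Finset.mul_sum]
  have hle : ∑ j : Fin (m + 1), missProb g (grover L j) ≤
      ENNReal.ofReal (3 / 4 * (m + 1 : ℕ)) := by
    refine (Finset.sum_le_sum fun (j : Fin (m + 1)) _ =>
      missProb_grover_le g hsinθ2 (j : ℕ)).trans ?_
    rw [← ENNReal.ofReal_sum_of_nonneg fun _ _ => sq_nonneg _,
      Fin.sum_univ_eq_sum_range (fun j => Real.cos ((2 * (j : ℝ) + 1) * θ) ^ 2)]
    exact ENNReal.ofReal_le_ofReal hsum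
  refine (mul_le_mul_right hle _).trans_eq ?_
  rw [ENNReal.ofReal_mul (by norm_num), ENNReal.ofReal_natCast, mul_comm, mul_assoc,
    ENNReal.mul_inv_cancel (by simp) (by simp), mul_one]

theorem pow_threshold_le {ε : ℝ} (hε : 0 < ε) : (3 / 4 : ℝ) ^ (2 * threshold ε) ≤ ε := by
  have hlog : Real.log (3 / 4) < 0 := Real.log_neg (by norm_num) (by norm_num)
  have h := Nat.le_ceil (Real.log ε / (2 * Real.log (3 / 4)))
  rw [div_le_iff_of_neg (by linarith)] at h
  rw [← Real.log_le_log_iff (by positivity) hε, Real.log_pow]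
  refine le_trans (le_of_eq ?_) h
  rw [threshold]
  push_cast
  ring

theorem ceil_log_inv_eq_threshold (ε : ℝ) :
    ⌈Real.log (1 / ε) / (2 * Real.log (4 / 3))⌉₊ = threshold ε := by
  rw [threshold, one_div, Real.log_inv, show (4 / 3 : ℝ) = (3 / 4)⁻¹ by norm_num, Real.log_inv,
    mul_neg, neg_div_neg_eq]

theorem failProb_qsearch_le (cq : ℕ) (g : L → Bool) {ε : ℝ} (hε : 0 < ε) :
    failProb cq g (qsearch L ε) ≤ ENNReal.ofReal ε := by
  rw [qsearch, exactPhase]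
  set T := threshold ε with hT
  set M := (Finset.univ.filter fun x => g x).card with hM
  rcases Nat.eq_zero_or_pos M with hM0 | hM0
  · have hg : ∀ x, g x = false := fun x => by
      have := Finset.filter_eq_empty_iff.1 (Finset.card_eq_zero.1 hM0) (Finset.mem_univ x)
      simpa using this
    refine (failProb_foldr_attempt_le _ _ _ _).trans ?_
    rw [failProb_randomPhase, failProb_output_none hg, mul_zero]
    exact zero_le
  rcases le_or_gt M T with hMT | hMT
  · rw [failProb_foldr_attempt_eq_zero cq g (t := M) (List.mem_range'_1.2 ⟨hM0, by omega⟩)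
      (missProb_exactGrover_eq_zero g hM0 hM.symm)]
    exact zero_le
  · refine (failProb_foldr_attempt_le _ _ _ _).trans ?_
    rw [failProb_randomPhase]
    refine (mul_le_of_le_one_right' (failProb_le_one _ _ _)).trans ?_
    refine le_trans ?_ (ENNReal.ofReal_le_ofReal (pow_threshold_le hε))
    rw [← hT, ENNReal.ofReal_pow (by norm_num)]
    rcases Nat.eq_zero_or_pos T with hT0 | hT0
    · rw [hT0, mul_zero, pow_zero, pow_zero]
    · exact pow_le_pow_left' (sum_missProb_grover_le g hT0 hMT.le (Nat.le_ceil _)) _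

theorem usesAtMost_qsearch (cq : ℕ) (g : L → Bool) (ε : ℝ) :
    UsesAtMost cq g (qsearch L ε)
      (∑ t ∈ Finset.range (threshold ε), (exactIterations L (t + 1) + 1) +
        2 * threshold ε * (⌈Real.pi / 4 * √(Fintype.card L / threshold ε)⌉₊ + 1)) :=
  usesAtMost_exactPhase (usesAtMost_randomPhase _ _ _ _) _

end Main

end ZalkaSearch

theorem mainTheorem3 {L : Type*} [Fintype L] [Nonempty L] (g : L → Bool) (cq : ℕ)
    (ε : ℝ) (hε : 0 < ε) :
    (∀ o ∈ ((ZalkaSearch.qsearch L ε).exec cq g).support,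
      (o.2 : ℝ) ≤ cq * (5 * (⌈Real.log (1 / ε) / (2 * Real.log (4 / 3))⌉₊ : ℝ)
        + Real.pi * √(Fintype.card L : ℝ) *
          √(⌈Real.log (1 / ε) / (2 * Real.log (4 / 3))⌉₊ : ℝ))) ∧
    ((ZalkaSearch.qsearch L ε).exec cq g).toOuterMeasure
      {o | ¬ ZalkaSearch.Correct g o.1} ≤ ENNReal.ofReal ε := by
  refine ⟨fun o ho => ?_, ZalkaSearch.failProb_qsearch_le cq g hε⟩
  rw [ZalkaSearch.ceil_log_inv_eq_threshold]
  have h : (o.2 : ℝ) ≤ ((cq * _ : ℕ) : ℝ) :=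
    Nat.cast_le.2 (ZalkaSearch.usesAtMost_qsearch cq g ε o ho)
  rw [Nat.cast_mul] at h
  exact h.trans (mul_le_mul_of_nonneg_left (ZalkaSearch.queries_le _) (Nat.cast_nonneg _))
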